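/- Let $M$ be a set of $n$ men and $W$ a set of $n$ women. A preference profile $\succ$ gives each man $m$ a strict total order $\succ_m$ on $W$ and each woman $w$ a strict total order $\succ_w$ on $M$. We write $x \succeq_a y$ for "$x \succ_a y$ or $x = y$". A matching $\mu$ is a bijection between $M$ and $W$; we write $\mu(m)$ and $\mu(w)$ for the partners of $m$ and $w$. It is stable with respect to $\succ$ if there is no pair $(m,w)$ with $w \succ_m \mu(m)$ and $m \succ_w \mu(w)$. We write $\mu \succeq_W \mu'$ if $\mu(w) \succeq_w \mu'(w)$ for all $w \in W$. Let $\mathrm{DA}(\succ)$ denote the matching computed by the men-proposing deferred acceptance algorithm on $\succ$: in each round, every unmatched man proposes to his favourite woman among those who have not rejected him yet, and each woman tentatively accepts her favourite among the new proposers and the man she holds, and rejects the others, until no further proposals can be made. Fix a true profile $\succ$ and a man $m \in M$ (the accomplice), and let $\mu := \mathrm{DA}(\succ)$. For a strict total order $\succ'_m$ on $W$ (a misreport of $m$), let $\mu' := \mathrm{DA}(\succ_{-m}, \succ'_m)$ be the matching computed when $m$ reports $\succ'_m$ and all other agents report truthfully. The misreport is no-regret if $\mu'(m) \succeq_m \mu(m)$.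 A no-regret misreport $\succ'_m$ is an optimal one-for-all strategy for the accomplice if $\mu' \succeq_W \mu$ and, for every no-regret misreport $\succ''_m$ with $\mu'' := \mathrm{DA}(\succ_{-m}, \succ''_m)$, we have $\mu' \succeq_W \mu''$. Then an optimal one-for-all strategy for the accomplice exists, and every optimal one-for-all strategy $\succ'_m$ is stability-preserving: the manipulated matching $\mathrm{DA}(\succ_{-m}, \succ'_m)$ is stable with respect to the true preferences $\succ$. -/

import Mathlib

namespace OneForAll

universe u v

/-- A preference list over `α`: a strict total order, `L.prefers a b` meaning that `a` is
ranked strictly above `b`. -/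
structure PrefList (α : Type u) where
  prefers : α → α → Prop
  isStrictTotalOrder : IsStrictTotalOrder α prefers

/-- `a` is weakly preferred to `b`: either `a` is ranked above `b`, or `a = b`. -/
def PrefList.weaklyPrefers {α : Type u} (L : PrefList α) (a b : α) : Prop :=
  L.prefers a b ∨ a = b

/-- `a` is the favourite element of `S` according to `L`. -/
def PrefList.IsFavourite {α : Type u} (L : PrefList α) (S : Set α) (a : α) : Prop :=
  a ∈ S ∧ ∀ b ∈ S, b ≠ a → L.prefers a b

/-- The favourite element of `S`, or `none` if there is none (for finite `α`: if `S` is empty). -/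
noncomputable def PrefList.favourite {α : Type u} (L : PrefList α) (S : Set α) : Option α :=
  open Classical in if h : ∃ a, L.IsFavourite S a then some h.choose else none

/-- A preference profile: a list over the women for each man, a list over the men for each woman. -/
structure Profile (M : Type u) (W : Type v) where
  men : M → PrefList W
  women : W → PrefList M

/-- The profile in which man `m` reports the list `L` and all other agents keep their lists. -/
noncomputable def Profile.withMan {M : Type u} {W : Type v} (P : Profile M W) (m : M)
    (L : PrefList W) : Profile M W where
  men := open Classical in Function.update P.men m L
  women := P.women

/-- State of deferred acceptance between two rounds: the proposal that each woman tentatively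
holds, and the relation "woman `w` has rejected man `m`". -/
structure DAState (M : Type u) (W : Type v) where
  held : W → Option M
  rejected : M → W → Prop

section DA

variable {M : Type u} {W : Type v}

/-- Initially no proposal is held and nobody has been rejected. -/
def DAState.init (M : Type u) (W : Type v) : DAState M W where
  held := fun _ => none
  rejected := fun _ _ => False

/-- Man `m` is currently unmatched. -/
def DAState.Unmatched (s : DAState M W) (m : M) : Prop := ∀ w, s.held w ≠ some m

/-- Proposal phase: man `m` is unmatched and proposes to `w`, his favourite among the women who
have not rejected him yet. -/
def DAState.Proposes (P : Profile M W) (s : DAState M W) (m : M) (w : W) : Prop :=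
  s.Unmatched m ∧ (P.men m).IsFavourite {w' | ¬ s.rejected m w'} w

/-- The men among whom `w` chooses in the rejection phase: the current proposers and the man whose
proposal she holds. -/
def DAState.candidates (P : Profile M W) (s : DAState M W) (w : W) : Set M :=
  {m | s.Proposes P m w ∨ s.held w = some m}

/-- One round (proposal phase and rejection phase) of deferred acceptance: each woman tentatively
accepts her favourite candidate and rejects the other ones. -/
noncomputable def DAState.step (P : Profile M W) (s : DAState M W) : DAState M W where
  held := fun w => (P.women w).favourite (s.candidates P w)
  rejected := fun m w => s.rejected m w ∨
    (m ∈ s.candidates P w ∧ (P.women w).favourite (s.candidates P w) ≠ some m)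

/-- The state after `k` rounds. -/
noncomputable def DAState.after (P : Profile M W) : ℕ → DAState M W
  | 0 => DAState.init M W
  | k + 1 => (DAState.after P k).step P

/-- The algorithm has terminated: no further proposal can be made. -/
def DAState.Terminated (P : Profile M W) (s : DAState M W) : Prop :=
  ∀ m w, ¬ s.Proposes P m w

theorem PrefList.exists_isFavourite {α : Type u} [Finite α] (L : PrefList α) {S : Set α}
    (hS : S.Nonempty) : ∃ a, L.IsFavourite S a := by
  have := L.isStrictTotalOrder
  obtain ⟨a, ha, hmin⟩ :=
    (Finite.wellFounded_of_trans_of_irrefl L.prefers).has_min S hS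
  refine ⟨a, ha, fun b hb hne => ?_⟩
  rcases trichotomous_of L.prefers a b with h | h | h
  · exact h
  · exact absurd h.symm hne
  · exact absurd h (hmin b hb)

theorem PrefList.favourite_spec {α : Type u} {L : PrefList α} {S : Set α} {a : α}
    (h : L.favourite S = some a) : L.IsFavourite S a := by
  unfold PrefList.favourite at h
  split_ifs at h with h'
  cases h
  exact h'.choose_spec

theorem PrefList.exists_favourite {α : Type u} [Finite α] (L : PrefList α) {S : Set α}
    (hS : S.Nonempty) : ∃ a, L.favourite S = some a := by
  unfold PrefList.favourite
  exact ⟨_, dif_pos (L.exists_isFavourite hS)⟩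

/-- Invariants of a run: no man is held by two women; a woman who has rejected somebody holds a
proposal; a man held by a woman is unrejected by her and she is his favourite such woman. -/
structure DAState.Good (P : Profile M W) (s : DAState M W) : Prop where
  inj : ∀ w w' m, s.held w = some m → s.held w' = some m → w = w'
  busy : ∀ m w, s.rejected m w → ∃ m', s.held w = some m'
  fav : ∀ m w, s.held w = some m → (P.men m).IsFavourite {w' | ¬ s.rejected m w'} w

theorem PrefList.IsFavourite.unique {α : Type u} {L : PrefList α} {S : Set α} {a b : α}
    (ha : L.IsFavourite S a) (hb : L.IsFavourite S b) : a = b := by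
  have := L.isStrictTotalOrder
  by_contra hne
  exact asymm_of L.prefers (ha.2 b hb.1 (Ne.symm hne)) (hb.2 a ha.1 hne)

theorem DAState.Good.candidates_fav {P : Profile M W} {s : DAState M W} (hs : s.Good P)
    {m : M} {w : W} (h : m ∈ s.candidates P w) :
    (P.men m).IsFavourite {w' | ¬ s.rejected m w'} w := by
  rcases h with h | h
  · exact h.2
  · exact hs.fav m w h

theorem DAState.Good.step [Finite M] {P : Profile M W} {s : DAState M W} (hs : s.Good P) :
    (s.step P).Good P where
  inj w w' m h h' := (hs.candidates_fav (PrefList.favourite_spec h).1).unique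
    (hs.candidates_fav (PrefList.favourite_spec h').1)
  busy m w h := by
    apply PrefList.exists_favourite
    rcases h with h | h
    · obtain ⟨m', hm'⟩ := hs.busy m w h
      exact ⟨m', Or.inr hm'⟩
    · exact ⟨m, h.1⟩
  fav m w h := by
    have hf := hs.candidates_fav (PrefList.favourite_spec h).1
    refine ⟨?_, fun b hb hne => hf.2 b (fun hr => hb (Or.inl hr)) hne⟩
    rintro (hr | hr)
    · exact hf.1 hr
    · exact hr.2 h

theorem DAState.good_after [Finite M] (P : Profile M W) (k : ℕ) :
    (DAState.after P k).Good P := by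
  induction k with
  | zero =>
    exact { inj := fun w w' m h => nomatch h
            busy := fun m w h => False.elim h
            fav := fun m w h => nomatch h }
  | succ k ih => exact ih.step

/-- The pairs `(m, w)` such that `m` has proposed to `w` so far. -/
def DAState.proposed (s : DAState M W) : Set (M × W) :=
  {p | s.rejected p.1 p.2 ∨ s.held p.2 = some p.1}

theorem DAState.proposed_subset_step (P : Profile M W) (s : DAState M W) :
    s.proposed ⊆ (s.step P).proposed := by
  rintro ⟨m, w⟩ (h | h)
  · exact Or.inl (Or.inl h)
  · by_cases hw : (P.women w).favourite (s.candidates P w) = some m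
    · exact Or.inr hw
    · exact Or.inl (Or.inr ⟨Or.inr h, hw⟩)

theorem DAState.proposed_ssubset_step {P : Profile M W} {s : DAState M W}
    (h : ¬ s.Terminated P) : s.proposed ⊂ (s.step P).proposed := by
  unfold DAState.Terminated at h
  push Not at h
  obtain ⟨m, w, hp⟩ := h
  refine (Set.ssubset_iff_of_subset (s.proposed_subset_step P)).2 ⟨(m, w), ?_, ?_⟩
  · by_cases hw : (P.women w).favourite (s.candidates P w) = some m
    · exact Or.inr hw
    · exact Or.inl (Or.inr ⟨Or.inl hp, hw⟩)
  · rintro (h | h)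
    · exact hp.2.1 h
    · exact hp.1 w h

theorem DAState.step_of_terminated [Finite M] {P : Profile M W} {s : DAState M W}
    (h : s.Terminated P) : s.step P = s := by
  have hc : ∀ w, s.candidates P w = {m | s.held w = some m} := fun w => by
    ext m
    exact ⟨fun hm => hm.resolve_left (h m w), Or.inr⟩
  have hf : ∀ w, (P.women w).favourite (s.candidates P w) = s.held w := fun w => by
    rw [hc]
    cases hw : s.held w with
    | none =>
      cases hx : (P.women w).favourite {m | none = some m} with
      | none => rfl
      | some a => exact absurd (PrefList.favourite_spec hx).1 (by simp)
    | some m =>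
      obtain ⟨a, ha⟩ := (P.women w).exists_favourite (S := {m' | some m = some m'}) ⟨m, rfl⟩
      rw [ha]
      exact ((PrefList.favourite_spec ha).1 : some m = some a).symm
  have hh : (s.step P).held = s.held := funext hf
  have hr : (s.step P).rejected = s.rejected := by
    funext m w
    refine propext ⟨?_, Or.inl⟩
    rintro (hr | ⟨h1, h2⟩)
    · exact hr
    · rw [hf] at h2
      rw [hc] at h1
      exact absurd h1 h2
  cases s
  exact (congr (congrArg DAState.mk hh) hr)

/-- Deferred acceptance terminates within `|M| * |W|` rounds. -/
theorem DAState.terminated_after [Fintype M] [Fintype W] (P : Profile M W) :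
    (DAState.after P (Fintype.card M * Fintype.card W)).Terminated P := by
  have key : ∀ k, (DAState.after P k).Terminated P ∨
      k ≤ (DAState.after P k).proposed.ncard := by
    intro k
    induction k with
    | zero => exact Or.inr (Nat.zero_le _)
    | succ k ih =>
      by_cases ht : (DAState.after P k).Terminated P
      · left
        have : DAState.after P (k + 1) = DAState.after P k := DAState.step_of_terminated ht
        rwa [this]
      · right
        have h1 := ih.resolve_left ht
        have h2 : (DAState.after P k).proposed.ncard < (DAState.after P (k + 1)).proposed.ncard :=
          Set.ncard_lt_ncard (DAState.proposed_ssubset_step ht) (Set.toFinite _)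
        omega
  rcases key (Fintype.card M * Fintype.card W) with h | h
  · exact h
  · intro m w hp
    have h2 : (DAState.after P (Fintype.card M * Fintype.card W)).proposed.ncard
        < (Set.univ : Set (M × W)).ncard := by
      refine Set.ncard_lt_ncard ((Set.ssubset_iff_of_subset (Set.subset_univ _)).2
        ⟨(m, w), Set.mem_univ _, ?_⟩) (Set.toFinite _)
      rintro (hr | hr)
      · exact hp.2.1 hr
      · exact hp.1 w hr
    rw [Set.ncard_univ, Nat.card_eq_fintype_card, Fintype.card_prod] at h2
    omega

/-- The state in which deferred acceptance terminates. -/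
noncomputable def DAState.final [Fintype M] [Fintype W] (P : Profile M W) : DAState M W :=
  DAState.after P (Fintype.card M * Fintype.card W)

theorem DAState.final_man_matched [Fintype M] [Fintype W]
    (hcard : Fintype.card M = Fintype.card W) (P : Profile M W) (m : M) :
    ∃ w, (DAState.final P).held w = some m := by
  have hg : (DAState.final P).Good P := DAState.good_after P _
  have ht : (DAState.final P).Terminated P := DAState.terminated_after P
  by_contra hm
  have hu : (DAState.final P).Unmatched m := fun w hw => hm ⟨w, hw⟩
  have hall : ∀ w, (DAState.final P).rejected m w := by
    by_contra hne
    push Not at hne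
    obtain ⟨w, hw⟩ := (P.men m).exists_isFavourite
      (S := {w' | ¬ (DAState.final P).rejected m w'}) hne
    exact ht m w ⟨hu, hw⟩
  choose f hf using fun w => hg.busy m w (hall w)
  have hinj : Function.Injective f := fun a b hab =>
    hg.inj a b (f a) (hf a) (by rw [hab]; exact hf b)
  have hbij := (Fintype.bijective_iff_injective_and_card f).2 ⟨hinj, hcard.symm⟩
  obtain ⟨w, hw⟩ := hbij.2 m
  exact hm ⟨w, by rw [← hw]; exact hf w⟩

theorem DAState.final_bijective [Fintype M] [Fintype W]
    (hcard : Fintype.card M = Fintype.card W) (P : Profile M W) :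
    Function.Bijective fun m => (DAState.final_man_matched hcard P m).choose := by
  refine (Fintype.bijective_iff_injective_and_card _).2 ⟨fun a b hab => ?_, hcard⟩
  have ha := (DAState.final_man_matched hcard P a).choose_spec
  have hb := (DAState.final_man_matched hcard P b).choose_spec
  have hab' : (DAState.final_man_matched hcard P a).choose =
      (DAState.final_man_matched hcard P b).choose := hab
  rw [hab'] at ha
  exact Option.some.inj (ha.symm.trans hb)

/-- The matching computed by man-proposing deferred acceptance: man `m` is matched to the woman
who holds his proposal when the algorithm terminates. A matching is a bijection `μ : M ≃ W`;
`μ m` is the partner of man `m` and `μ.symm w` the partner of woman `w`. -/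
noncomputable def DA [Fintype M] [Fintype W] (hcard : Fintype.card M = Fintype.card W)
    (P : Profile M W) : M ≃ W :=
  Equiv.ofBijective _ (DAState.final_bijective hcard P)

/-- The defining property of `DA`. -/
theorem DA_spec [Fintype M] [Fintype W] (hcard : Fintype.card M = Fintype.card W)
    (P : Profile M W) (m : M) : (DAState.final P).held (DA hcard P m) = some m :=
  (DAState.final_man_matched hcard P m).choose_spec

end DA

section Manipulation

variable {M : Type u} {W : Type v}

/-- `(m, w)` blocks `μ` with respect to `P`: they prefer each other over their partners. -/
def Blocks (P : Profile M W) (μ : M ≃ W) (m : M) (w : W) : Prop :=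
  (P.men m).prefers w (μ m) ∧ (P.women w).prefers m (μ.symm w)

/-- `μ` is stable with respect to `P`: there is no blocking pair. -/
def Stable (P : Profile M W) (μ : M ≃ W) : Prop := ∀ m w, ¬ Blocks P μ m w

/-- All women weakly prefer `μ` over `μ'`, according to `P`. -/
def WomenWeaklyPrefer (P : Profile M W) (μ μ' : M ≃ W) : Prop :=
  ∀ w, (P.women w).weaklyPrefers (μ.symm w) (μ'.symm w)

variable [Fintype M] [Fintype W]

/-- Misreporting `L` causes no regret for man `m`: according to his true list, his match does not
worsen. -/
def NoRegret (hcard : Fintype.card M = Fintype.card W) (P : Profile M W) (m : M)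
    (L : PrefList W) : Prop :=
  (P.men m).weaklyPrefers (DA hcard (P.withMan m L) m) (DA hcard P m)

/-- `L` is an optimal one-for-all strategy of the accomplice `m` when the true profile is `P`.
The strategies of the accomplice are his no-regret lists. -/
def IsOptimalOneForAll (hcard : Fintype.card M = Fintype.card W) (P : Profile M W) (m : M)
    (L : PrefList W) : Prop :=
  NoRegret hcard P m L ∧
  WomenWeaklyPrefer P (DA hcard (P.withMan m L)) (DA hcard P) ∧
  ∀ L' : PrefList W, NoRegret hcard P m L' →
    WomenWeaklyPrefer P (DA hcard (P.withMan m L)) (DA hcard (P.withMan m L'))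

/-- The strategy `L` of man `m` is stability-preserving: the manipulated deferred acceptance
matching is stable with respect to the true preferences. -/
def StabilityPreserving (hcard : Fintype.card M = Fintype.card W) (P : Profile M W) (m : M)
    (L : PrefList W) : Prop :=
  Stable P (DA hcard (P.withMan m L))

end Manipulation

end OneForAll

/-!
Fix the reports of everybody but the man `m`. Strategy-proofness of deferred acceptance says that
`m` is always matched to his reported favourite among the women he can be matched to by some report.
Hence a report is no-regret exactly if it ranks only unattainable women above the true partner of
`m`, and the report that moves all unattainable women to the top of the true list is the no-regret
report with the most women above that partner.

Moving women up in the list of `m`, past a partner he keeps, only enlarges the set of potential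
blocking pairs. So the matching obtained from that report is stable for the true profile and for
every profile with a no-regret report. As deferred acceptance yields the stable matching that is
worst for the women, this matching is the best one for them. Both strategy-proofness and the
men-optimality of deferred acceptance follow from the blocking lemma of Gale and Sotomayor.
-/

namespace OneForAll

namespace PrefList

variable {α : Type*} {L : PrefList α} {a b c : α} {S : Set α}

instance (L : PrefList α) : IsStrictTotalOrder α L.prefers :=
  L.isStrictTotalOrder

theorem not_prefers_iff : ¬ L.prefers a b ↔ L.weaklyPrefers b a := by
  constructor
  · intro h
    rcases trichotomous_of L.prefers a b with hab | rfl | hba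
    exacts [absurd hab h, Or.inr rfl, Or.inl hba]
  · rintro (h | rfl)
    exacts [asymm h, irrefl _]

theorem prefers.trans_weaklyPrefers (hab : L.prefers a b) (hbc : L.weaklyPrefers b c) :
    L.prefers a c := by
  rcases hbc with hbc | rfl
  exacts [_root_.trans hab hbc, hab]

theorem weaklyPrefers.trans_prefers (hab : L.weaklyPrefers a b) (hbc : L.prefers b c) :
    L.prefers a c := by
  rcases hab with hab | rfl
  exacts [_root_.trans hab hbc, hbc]

theorem weaklyPrefers.antisymm (hab : L.weaklyPrefers a b) (hba : L.weaklyPrefers b a) : a = b :=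
  hab.resolve_left (not_prefers_iff.2 hba)

theorem isFavourite_iff_weaklyPrefers :
    L.IsFavourite S a ↔ a ∈ S ∧ ∀ b ∈ S, L.weaklyPrefers a b := by
  refine and_congr_right fun _ => forall₂_congr fun b _ => ?_
  rw [weaklyPrefers, or_iff_not_imp_right, ne_comm]

theorem IsFavourite.weaklyPrefers (h : L.IsFavourite S a) (hb : b ∈ S) : L.weaklyPrefers a b :=
  (isFavourite_iff_weaklyPrefers.1 h).2 b hb

theorem IsFavourite.notMem_of_prefers (h : L.IsFavourite S a) (hb : L.prefers b a) : b ∉ S :=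
  fun hbS => not_prefers_iff.2 (h.weaklyPrefers hbS) hb

/-- The list that ranks the elements of `U` above all others and otherwise agrees with `L`. -/
def prioritize (L : PrefList α) (U : Set α) : PrefList α where
  prefers a b := (a ∈ U ∧ b ∉ U) ∨ ((a ∈ U ↔ b ∈ U) ∧ L.prefers a b)
  isStrictTotalOrder :=
    { trichotomous := fun a b => by
        have := trichotomous_of L.prefers a b
        tauto
      irrefl := fun a => by
        have := irrefl_of L.prefers a
        tauto
      trans := fun a b c => by
        have := @trans_of _ L.prefers a b c
        tauto }

theorem prioritize_prefers_iff_of_notMem {U : Set α} (hb : b ∉ U) :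
    (L.prioritize U).prefers a b ↔ a ∈ U ∨ L.prefers a b := by
  simp only [prioritize]
  tauto

theorem IsFavourite.prioritize_compl (h : L.IsFavourite S a) :
    (L.prioritize Sᶜ).IsFavourite S a :=
  ⟨h.1, fun b hb hne =>
    (prioritize_prefers_iff_of_notMem (Set.notMem_compl_iff.2 hb)).2 (Or.inr (h.2 b hb hne))⟩

end PrefList

section Matchings

variable {M W : Type*} {P : Profile M W} {m : M} {μ ν : M ≃ W}

theorem Profile.withMan_men_self (L : PrefList W) : (P.withMan m L).men m = L := by
  simp [Profile.withMan]

theorem Profile.withMan_men_of_ne {x : M} (h : x ≠ m) (L : PrefList W) :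
    (P.withMan m L).men x = P.men x := by
  simp [Profile.withMan, h]

theorem Profile.withMan_withMan (L L' : PrefList W) :
    (P.withMan m L).withMan m L' = P.withMan m L' := by
  simp [Profile.withMan]

theorem Profile.withMan_eq_self : P.withMan m (P.men m) = P := by
  simp [Profile.withMan]

theorem Stable.of_withMan {L L' : PrefList W} (h : Stable (P.withMan m L') ν)
    (hL : ∀ w, L.prefers w (ν m) → L'.prefers w (ν m)) : Stable (P.withMan m L) ν := by
  rintro x w ⟨hx, hw⟩
  refine h x w ⟨?_, hw⟩
  rcases eq_or_ne x m with rfl | hne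
  · rw [Profile.withMan_men_self] at hx ⊢
    exact hL w hx
  · rwa [Profile.withMan_men_of_ne hne] at hx ⊢

theorem Stable.womenWeaklyPrefer_of_men (hν : Stable P ν)
    (h : ∀ x, (P.men x).weaklyPrefers (μ x) (ν x)) : WomenWeaklyPrefer P ν μ := by
  intro w
  obtain ⟨x, rfl⟩ := μ.surjective w
  rw [μ.symm_apply_apply]
  rcases h x with hx | hx
  · exact PrefList.not_prefers_iff.1 fun hw => hν x (μ x) ⟨hx, hw⟩
  · exact Or.inr (by rw [hx, ν.symm_apply_apply])

theorem WomenWeaklyPrefer.antisymm (h : WomenWeaklyPrefer P μ ν) (h' : WomenWeaklyPrefer P ν μ) :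
    μ = ν :=
  Equiv.symm_bijective.injective (Equiv.ext fun w => (h w).antisymm (h' w))

theorem Stable.blocks_of_prefers_of_not_prefers (hμ : Stable P μ) {x y : M} (hxy : μ x = ν y)
    (hy : (P.men y).prefers (ν y) (μ y)) (hx : ¬ (P.men x).prefers (ν x) (μ x)) :
    Blocks P ν x (μ x) := by
  have hne : x ≠ y := by
    rintro rfl
    exact hx hy
  constructor
  · refine (PrefList.not_prefers_iff.1 hx).resolve_right fun h => hne ?_
    exact ν.injective (h.symm.trans hxy)
  · have hw : ¬ (P.women (ν y)).prefers y (μ.symm (ν y)) := fun h => hμ y (ν y) ⟨hy, h⟩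
    rw [← hxy, μ.symm_apply_apply] at hw
    rw [hxy, ν.symm_apply_apply, ← hxy]
    exact (PrefList.not_prefers_iff.1 hw).resolve_right hne

end Matchings

section DeferredAcceptance

variable {M W : Type*} {P : Profile M W}

theorem DAState.Good.rejected_of_prefers {s : DAState M W} (hs : s.Good P) {m : M} {w w' : W}
    (hm : s.held w = some m) (h : (P.men m).prefers w' w) : s.rejected m w' :=
  not_not.1 ((hs.fav m w hm).notMem_of_prefers h)

theorem DAState.exists_step_held_weaklyPrefers [Finite M] {s : DAState M W} {m : M} {w : W}
    (hm : m ∈ s.candidates P w) :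
    ∃ a, (s.step P).held w = some a ∧ (P.women w).weaklyPrefers a m := by
  obtain ⟨a, ha⟩ := (P.women w).exists_favourite ⟨m, hm⟩
  exact ⟨a, ha, (PrefList.favourite_spec ha).weaklyPrefers hm⟩

theorem DAState.exists_held_prefers_of_rejected [Finite M] {k : ℕ} {m : M} {w : W}
    (h : (DAState.after P k).rejected m w) :
    ∃ a, (DAState.after P k).held w = some a ∧ (P.women w).prefers a m := by
  induction k with
  | zero => exact h.elim
  | succ k ih =>
    rcases h with hbefore | ⟨hcand, hne⟩
    · obtain ⟨b, hb, hbm⟩ := ih hbefore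
      obtain ⟨a, ha, hab⟩ := DAState.exists_step_held_weaklyPrefers (P := P) (Or.inr hb)
      exact ⟨a, ha, hab.trans_prefers hbm⟩
    · obtain ⟨a, ha, ham⟩ := DAState.exists_step_held_weaklyPrefers hcand
      refine ⟨a, ha, ham.resolve_right ?_⟩
      rintro rfl
      exact hne ha

theorem DAState.monotone_rejected_after (P : Profile M W) :
    Monotone fun k => (DAState.after P k).rejected :=
  monotone_nat_of_le_succ fun _ _ _ => Or.inl

variable [Fintype M] [Fintype W] (hcard : Fintype.card M = Fintype.card W)

theorem DA_stable (P : Profile M W) : Stable P (DA hcard P) := by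
  rintro m w ⟨hm, hw⟩
  have hrej : (DAState.final P).rejected m w :=
    (DAState.good_after P _).rejected_of_prefers (DA_spec hcard P m) hm
  obtain ⟨a, ha, ham⟩ := DAState.exists_held_prefers_of_rejected hrej
  have hheld := DA_spec hcard P ((DA hcard P).symm w)
  rw [Equiv.apply_symm_apply] at hheld
  rw [Option.some.inj (hheld.symm.trans ha)] at hw
  exact asymm hw ham

theorem weaklyPrefers_DA_of_held {k : ℕ} (hk : k ≤ Fintype.card M * Fintype.card W) {m : M} {w : W}
    (h : (DAState.after P k).held w = some m) : (P.men m).weaklyPrefers w (DA hcard P m) := by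
  refine ((DAState.good_after P k).fav m w h).weaklyPrefers fun hrej => ?_
  exact ((DAState.good_after P _).fav m _ (DA_spec hcard P m)).1
    (DAState.monotone_rejected_after P hk m _ hrej)

theorem exists_last_round_held_DA (P : Profile M W) {S : Set M} (hS : S.Nonempty) :
    ∃ k < Fintype.card M * Fintype.card W,
      (∀ x ∈ S, (DAState.after P (k + 1)).held (DA hcard P x) = some x) ∧
      ∃ x ∈ S, (DAState.after P k).held (DA hcard P x) ≠ some x := by
  classical
  have hfinal : ∀ x ∈ S, (DAState.final P).held (DA hcard P x) = some x :=
    fun x _ => DA_spec hcard P x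
  have hex : ∃ k, ∀ x ∈ S, (DAState.after P k).held (DA hcard P x) = some x := ⟨_, hfinal⟩
  have hpos : Nat.find hex ≠ 0 := by
    intro h
    obtain ⟨x, hx⟩ := hS
    exact nomatch (Nat.find_eq_zero hex).1 h x hx
  obtain ⟨k, hk⟩ := Nat.exists_eq_add_one_of_ne_zero hpos
  have hlast : k < Nat.find hex := hk ▸ k.lt_succ_self
  have hspec := Nat.find_spec hex
  rw [hk] at hspec
  refine ⟨k, hlast.trans_le (Nat.find_min' hex hfinal), hspec, ?_⟩
  simpa only [not_forall, exists_prop] using Nat.find_min hex hlast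

theorem exists_notMem_prefers_DA_of_mapsTo {S : Set M} (hS : S.Nonempty) {g : M → M}
    (hg : S.MapsTo g S)
    (hpref : ∀ x ∈ S, (P.men (g x)).prefers (DA hcard P x) (DA hcard P (g x))) :
    ∃ x ∈ S, ∃ z ∉ S, (P.men z).prefers (DA hcard P x) (DA hcard P z) ∧
      (P.women (DA hcard P x)).prefers z (g x) := by
  -- `x` is a last man of `S` to reach his final partner, and `z` is the man whom he displaces.
  obtain ⟨k, hk, hsettled, x, hx, hxk⟩ := exists_last_round_held_DA hcard P hS
  set μ := DA hcard P
  have eq_of_candidate : ∀ y ∈ S, ∀ w, y ∈ (DAState.after P k).candidates P w → w = μ y :=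
    fun y hy w hw => ((DAState.good_after P k).candidates_fav hw).unique
      ((DAState.good_after P k).candidates_fav (PrefList.favourite_spec (hsettled y hy)).1)
  have hrej : (DAState.after P k).rejected (g x) (μ x) := by
    refine ((DAState.good_after P (k + 1)).rejected_of_prefers (hsettled _ (hg hx))
      (hpref x hx)).resolve_right fun h => ?_
    have hpref := hpref x hx
    rw [eq_of_candidate _ (hg hx) _ h.1] at hpref
    exact irrefl _ hpref
  obtain ⟨z, hz, hzg⟩ := DAState.exists_held_prefers_of_rejected hrej
  have hxz : μ x ≠ μ z := fun h => hxk (μ.injective h ▸ hz)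
  refine ⟨x, hx, z, fun hzS => hxz (eq_of_candidate z hzS _ (Or.inr hz)), ?_, hzg⟩
  exact (weaklyPrefers_DA_of_held hcard hk.le hz).resolve_right hxz

theorem exists_blocks_of_prefers_DA {ν : M ≃ W} {m : M}
    (hm : (P.men m).prefers (ν m) (DA hcard P m)) :
    ∃ x w, ¬ (P.men x).prefers (ν x) (DA hcard P x) ∧ Blocks P ν x w := by
  set μ := DA hcard P
  let S : Set M := {x | (P.men x).prefers (ν x) (μ x)}
  let e : Equiv.Perm M := ν.trans μ.symm
  by_cases hmaps : S.MapsTo e S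
  · have hinv : S.MapsTo e.symm S := Equiv.Perm.perm_symm_mapsTo_of_mapsTo e hmaps
    have hpref : ∀ x ∈ S, (P.men (e.symm x)).prefers (μ x) (μ (e.symm x)) := by
      intro x hx
      simpa [S, e] using hinv hx
    obtain ⟨x, -, z, hz, hzx, hzw⟩ := exists_notMem_prefers_DA_of_mapsTo hcard ⟨m, hm⟩ hinv hpref
    exact ⟨z, μ x, hz, hzx.trans_weaklyPrefers (PrefList.not_prefers_iff.1 hz), hzw⟩
  · obtain ⟨y, hy, hey⟩ : ∃ y ∈ S, e y ∉ S := by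
      simpa only [Set.MapsTo, not_forall, exists_prop] using hmaps
    exact ⟨e y, μ (e y), hey, (DA_stable hcard P).blocks_of_prefers_of_not_prefers
      (μ.apply_symm_apply (ν y)) hy hey⟩

theorem Stable.DA_weaklyPrefers {ν : M ≃ W} (hν : Stable P ν) (m : M) :
    (P.men m).weaklyPrefers (DA hcard P m) (ν m) := by
  refine PrefList.not_prefers_iff.1 fun hm => ?_
  obtain ⟨x, w, -, hblocks⟩ := exists_blocks_of_prefers_DA hcard hm
  exact hν x w hblocks

theorem DA_strategyproof (P : Profile M W) (m : M) (L : PrefList W) :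
    (P.men m).weaklyPrefers (DA hcard P m) (DA hcard (P.withMan m L) m) := by
  refine PrefList.not_prefers_iff.1 fun hm => ?_
  obtain ⟨x, w, hx, hblocks⟩ := exists_blocks_of_prefers_DA hcard hm
  have hne : x ≠ m := by
    rintro rfl
    exact hx hm
  refine DA_stable hcard (P.withMan m L) x w ⟨?_, hblocks.2⟩
  rw [Profile.withMan_men_of_ne hne]
  exact hblocks.1

end DeferredAcceptance

section Accomplice

variable {M W : Type*} [Fintype M] [Fintype W] (hcard : Fintype.card M = Fintype.card W)
  (P : Profile M W) (m : M)

/-- The women to whom `m` can be matched by some report, given the lists of the other agents. -/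
def attainable : Set W :=
  Set.range fun L : PrefList W => DA hcard (P.withMan m L) m

/-- The report of `m` that moves the unattainable women to the top of his true list. It is an
optimal one-for-all strategy, see `isOptimalOneForAll_promoteUnattainable`. -/
def promoteUnattainable : PrefList W :=
  (P.men m).prioritize (attainable hcard P m)ᶜ

theorem DA_withMan_isFavourite_attainable (L : PrefList W) :
    L.IsFavourite (attainable hcard P m) (DA hcard (P.withMan m L) m) := by
  refine PrefList.isFavourite_iff_weaklyPrefers.2 ⟨⟨L, rfl⟩, ?_⟩
  rintro _ ⟨L', rfl⟩
  simpa only [Profile.withMan_men_self, Profile.withMan_withMan] using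
    DA_strategyproof hcard (P.withMan m L) m L'

theorem DA_isFavourite_attainable :
    (P.men m).IsFavourite (attainable hcard P m) (DA hcard P m) := by
  simpa only [Profile.withMan_eq_self] using
    DA_withMan_isFavourite_attainable hcard P m (P.men m)

theorem DA_promoteUnattainable_apply :
    DA hcard (P.withMan m (promoteUnattainable hcard P m)) m = DA hcard P m :=
  (DA_withMan_isFavourite_attainable hcard P m _).unique
    (DA_isFavourite_attainable hcard P m).prioritize_compl

variable {P m}

theorem noRegret_iff {L : PrefList W} :
    NoRegret hcard P m L ↔ DA hcard (P.withMan m L) m = DA hcard P m :=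
  ⟨fun h => h.antisymm (DA_strategyproof hcard P m L), Or.inr⟩

theorem NoRegret.promoteUnattainable_prefers {L : PrefList W} (hL : NoRegret hcard P m L) {w : W}
    (hw : L.prefers w (DA hcard P m)) :
    (promoteUnattainable hcard P m).prefers w (DA hcard P m) := by
  have hfav := DA_withMan_isFavourite_attainable hcard P m L
  rw [(noRegret_iff hcard).1 hL] at hfav
  exact (PrefList.prioritize_prefers_iff_of_notMem (Set.notMem_compl_iff.2 hfav.1)).2
    (Or.inl (hfav.notMem_of_prefers hw))

theorem NoRegret.stable_promoteUnattainable {L : PrefList W} (hL : NoRegret hcard P m L) :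
    Stable (P.withMan m L) (DA hcard (P.withMan m (promoteUnattainable hcard P m))) := by
  refine (DA_stable hcard _).of_withMan fun w hw => ?_
  rw [DA_promoteUnattainable_apply] at hw ⊢
  exact hL.promoteUnattainable_prefers hcard hw

theorem NoRegret.womenWeaklyPrefer_promoteUnattainable {L : PrefList W}
    (hL : NoRegret hcard P m L) :
    WomenWeaklyPrefer P (DA hcard (P.withMan m (promoteUnattainable hcard P m)))
      (DA hcard (P.withMan m L)) :=
  have hstable := hL.stable_promoteUnattainable hcard
  hstable.womenWeaklyPrefer_of_men (hstable.DA_weaklyPrefers hcard)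

variable (P m)

theorem noRegret_men : NoRegret hcard P m (P.men m) :=
  (noRegret_iff hcard).2 (by rw [Profile.withMan_eq_self])

theorem isOptimalOneForAll_promoteUnattainable :
    IsOptimalOneForAll hcard P m (promoteUnattainable hcard P m) := by
  refine ⟨(noRegret_iff hcard).2 (DA_promoteUnattainable_apply hcard P m), ?_,
    fun L hL => hL.womenWeaklyPrefer_promoteUnattainable hcard⟩
  simpa only [Profile.withMan_eq_self] using
    (noRegret_men hcard P m).womenWeaklyPrefer_promoteUnattainable hcard

theorem stabilityPreserving_promoteUnattainable :
    StabilityPreserving hcard P m (promoteUnattainable hcard P m) := by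
  simpa only [StabilityPreserving, Profile.withMan_eq_self] using
    (noRegret_men hcard P m).stable_promoteUnattainable hcard

variable {P m}

theorem IsOptimalOneForAll.DA_eq {L L' : PrefList W} (h : IsOptimalOneForAll hcard P m L)
    (h' : IsOptimalOneForAll hcard P m L') :
    DA hcard (P.withMan m L) = DA hcard (P.withMan m L') :=
  (h.2.2 L' h'.1).antisymm (h'.2.2 L h.1)

end Accomplice

end OneForAll

theorem mainTheorem7 {M : Type*} {W : Type*} [Fintype M] [Fintype W]
    (hcard : Fintype.card M = Fintype.card W) (P : OneForAll.Profile M W) (m : M) :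
    (∃ L : OneForAll.PrefList W, OneForAll.IsOptimalOneForAll hcard P m L) ∧
    ∀ L : OneForAll.PrefList W, OneForAll.IsOptimalOneForAll hcard P m L →
      OneForAll.StabilityPreserving hcard P m L := by
  have hopt := OneForAll.isOptimalOneForAll_promoteUnattainable hcard P m
  refine ⟨⟨_, hopt⟩, fun L hL => ?_⟩
  rw [OneForAll.StabilityPreserving, hL.DA_eq hcard hopt]
  exact OneForAll.stabilityPreserving_promoteUnattainable hcard P m
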